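/- Let $A\in\mathbb Z^{m\times n}$ have full row rank, let $b\in\mathbb Z^m$, and consider for $d\in\mathbb R^n$ the integer program $\mathcal{IP}^d:\ \min\{d^\top x : Ax=b,\ x\ge 0,\ x\in\mathbb Z^n\}$. A feasible basis (of the linear relaxation) is a set $B\subseteq\{1,\dots,n\}$ with $|B|=m$ such that the matrix $A_B$ of the columns of $A$ indexed by $B$ is nonsingular and $A_B^{-1}b\ge 0$; let $\mathcal B$ be the set of all feasible bases. For $B\in\mathcal B$ the Gomory corner relaxation $\mathcal G^{B,d}$ is $\min\{d^\top x : Ax=b,\ x_i\ge 0\ (i\notin B),\ x\in\mathbb Z^n\}$. For a feasible solution $x^\circ$ of $\mathcal{IP}$, let $\mathrm{IFR}(\mathcal{IP},x^\circ)$ and $\mathrm{IFR}(\mathcal G^{B},x^\circ)$ be the sets of all $d\in\mathbb R^n$ for which $x^\circ$ is an optimal solution of $\mathcal{IP}^d$ and of $\mathcal G^{B,d}$, respectively. Suppose that $x^\circ$ is a feasible solution of $\mathcal{IP}$ and that, for every $B\in\mathcal B$, the Euclidean distance from $b$ to the boundary of the cone $\{y\in\mathbb R^m : A_B^{-1}y\ge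 0\}$ is at least $|\det A_B|\cdot\max_{j\notin B}\lVert A_j\rVert_2$, where $A_j$ is the $j$-th column of $A$ (the maximum is $0$ if $m=n$). Then $$\bigcup_{B\in\mathcal B}\mathrm{IFR}(\mathcal G^{B},x^\circ)=\mathrm{IFR}(\mathcal{IP},x^\circ).$$ Consequently, for every $p\in[1,\infty]$, every target vector $c\in\mathbb R^n$ and all positive weights $w_1,\dots,w_n$, writing $\lVert z\rVert_{p,w}=\lVert (w_1z_1,\dots,w_nz_n)\rVert_p$, the inverse problems $\min\{\lVert d-c\rVert_{p,w}: d\in \mathrm{IFR}(\mathcal G^{B},x^\circ)\}$ $(B\in\mathcal B)$ and $\min\{\lVert d-c\rVert_{p,w}: d\in \mathrm{IFR}(\mathcal{IP},x^\circ)\}$ attain their minima, and $$\min_{B\in\mathcal B}\ \min_{d\in \mathrm{IFR}(\mathcal G^{B},x^\circ)}\lVert d-c\rVert_{p,w}=\min_{d\in \mathrm{IFR}(\mathcal{IP},x^\circ)}\lVert d-c\rVert_{p,w};$$ moreover, $d$ is an optimal solution of the inverse integer program if and only if, for some $B\in\mathcal B$, it is an optimal solution of the inverse problem of $\mathcal G^{B}$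 and $\lVert d-c\rVert_{p,w}$ equals this common minimum. -/

import Mathlib

open scoped ENNReal

namespace InverseIP

noncomputable section

/-- The matrix `A` with its integer entries read as real numbers. -/
def realMatrix {m n : ℕ} (A : Matrix (Fin m) (Fin n) ℤ) : Matrix (Fin m) (Fin n) ℝ :=
  A.map (fun z : ℤ => (z : ℝ))

/-- An integer vector read as a real vector. -/
def realVec {k : ℕ} (v : Fin k → ℤ) : Fin k → ℝ := fun i => (v i : ℝ)

/-- Feasible region of the integer program `min {dᵀ x : A x = b, x ≥ 0, x ∈ ℤⁿ}`. -/
def ipFeasible {m n : ℕ} (A : Matrix (Fin m) (Fin n) ℤ) (b : Fin m → ℤ) : Set (Fin n → ℤ) :=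
  {x | A.mulVec x = b ∧ ∀ i, 0 ≤ x i}

/-- Feasible region of the Gomory corner relaxation for the index set `B`: the nonnegativity of the
variables with index in `B` is dropped, all variables remain integral. -/
def gcrFeasible {m n : ℕ} (A : Matrix (Fin m) (Fin n) ℤ) (b : Fin m → ℤ) (B : Finset (Fin n)) :
    Set (Fin n → ℤ) :=
  {x | A.mulVec x = b ∧ ∀ i, i ∉ B → 0 ≤ x i}

/-- The objective value `dᵀ x`. -/
def cost {n : ℕ} (d : Fin n → ℝ) (x : Fin n → ℤ) : ℝ := d ⬝ᵥ realVec x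

/-- `x` is an optimal solution of `min {dᵀ y : y ∈ F}`. -/
def IsOptimalSolution {n : ℕ} (F : Set (Fin n → ℤ)) (d : Fin n → ℝ) (x : Fin n → ℤ) : Prop :=
  x ∈ F ∧ ∀ y ∈ F, cost d x ≤ cost d y

/-- Inverse-feasible region with respect to `x₀` of the problem with feasible region `F`: the
objective vectors `d ∈ ℝⁿ` for which `x₀` is an optimal solution. -/
def inverseFeasible {n : ℕ} (F : Set (Fin n → ℤ)) (x₀ : Fin n → ℤ) : Set (Fin n → ℝ) :=
  {d | IsOptimalSolution F d x₀}

/-- The square matrix `A_B` of the columns of `A` with index in `B`, in increasing order. -/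
def basisMatrix {m n : ℕ} (A : Matrix (Fin m) (Fin n) ℤ) (B : Finset (Fin n)) (hB : B.card = m) :
    Matrix (Fin m) (Fin m) ℝ :=
  (realMatrix A).submatrix id (B.orderEmbOfFin hB)

/-- The feasible bases of the linear relaxation: `|B| = m`, `A_B` is nonsingular and the basic
solution `x_B = A_B⁻¹ b`, `x_N = 0` is nonnegative. -/
def feasibleBases {m n : ℕ} (A : Matrix (Fin m) (Fin n) ℤ) (b : Fin m → ℤ) :
    Set (Finset (Fin n)) :=
  {B | ∃ hB : B.card = m,
    (basisMatrix A B hB).det ≠ 0 ∧ ∀ i, 0 ≤ ((basisMatrix A B hB)⁻¹.mulVec (realVec b)) i}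

/-- The cone `{y ∈ ℝᵐ : A_B⁻¹ y ≥ 0}`, in Euclidean space. -/
def basisCone {m n : ℕ} (A : Matrix (Fin m) (Fin n) ℤ) (B : Finset (Fin n)) (hB : B.card = m) :
    Set (EuclideanSpace ℝ (Fin m)) :=
  {y | ∀ i, 0 ≤ ((basisMatrix A B hB)⁻¹.mulVec y.ofLp) i}

/-- The Euclidean norm of the `j`-th column of `A`. -/
def columnNorm {m n : ℕ} (A : Matrix (Fin m) (Fin n) ℤ) (j : Fin n) : ℝ :=
  ‖(WithLp.toLp 2 (fun i => realMatrix A i j) : EuclideanSpace ℝ (Fin m))‖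

/-- Gomory's asymptotic condition at `B`: the Euclidean distance from `b` to the boundary of the cone
`{y : A_B⁻¹ y ≥ 0}` is at least `|det A_B|` times the largest norm of a nonbasic column (the largest
norm is `0` if there is no nonbasic column). -/
def GomoryCondition {m n : ℕ} (A : Matrix (Fin m) (Fin n) ℤ) (b : Fin m → ℤ)
    (B : Finset (Fin n)) (hB : B.card = m) : Prop :=
  |(basisMatrix A B hB).det| * (⨆ j : {j : Fin n // j ∉ B}, columnNorm A j) ≤
    Metric.infDist (WithLp.toLp 2 (realVec b) : EuclideanSpace ℝ (Fin m))
      (frontier (basisCone A B hB))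

/-- The weighted `L_p` distance `‖(w₁ (d₁ - c₁), …, wₙ (dₙ - cₙ))‖_p`. -/
def weightedDist {n : ℕ} (p : ℝ≥0∞) (w c d : Fin n → ℝ) : ℝ :=
  ‖(WithLp.toLp p (fun i => w i * (d i - c i)) : PiLp p (fun _ : Fin n => ℝ))‖

/-- `v` is the optimal value (an attained minimum) of the inverse problem with feasible region `F`,
given solution `x₀` and target objective vector `c`. -/
def IsInverseValue {n : ℕ} (p : ℝ≥0∞) (w c : Fin n → ℝ) (F : Set (Fin n → ℤ)) (x₀ : Fin n → ℤ)
    (v : ℝ) : Prop :=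
  IsLeast (weightedDist p w c '' inverseFeasible F x₀) v

/-- `d` is an optimal solution of the inverse problem with feasible region `F`, given solution `x₀`
and target objective vector `c`. -/
def IsInverseSolution {n : ℕ} (p : ℝ≥0∞) (w c : Fin n → ℝ) (F : Set (Fin n → ℤ))
    (x₀ : Fin n → ℤ) (d : Fin n → ℝ) : Prop :=
  d ∈ inverseFeasible F x₀ ∧ ∀ e ∈ inverseFeasible F x₀, weightedDist p w c d ≤ weightedDist p w c e

end

end InverseIP

open InverseIP

/-! A corner relaxation enlarges the feasible region, so its inverse-feasible region lies in that of
the integer program. Conversely, let `d` make `x₀` optimal for the integer program.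

Some feasible basis `B` has nonnegative reduced costs (`exists_dualFeasible_basis`): take one whose
basic solution is cheapest. Suppose column `j` had negative reduced cost. If its coordinates in `B`
were all nonpositive, an integer multiple of the resulting ray could be added to `x₀` at negative
cost. Otherwise `A_j ≠ 0`, the distance condition makes the basic solution nondegenerate, and a
pivot reaches a strictly cheaper feasible basis; no anticycling rule is needed.

For this `B`, Gomory's argument turns any corner-feasible `y` into a no more expensive `y'` with
nonbasic sum below `|det A_B|` (`exists_gcrFeasible_sum_lt`). The group `ℤᵐ / A_B ℤᵐ` has order
`|det A_B|`, so a larger sum contains a nonempty collection of nonbasic columns that vanishes in the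
group; it can be removed and compensated by basic variables. Then `A_B y'_B` differs from `b` by
fewer than `|det A_B|` nonbasic columns, too little to leave the basis cone
(`mem_ipFeasible_of_gomoryCondition`). So `y'` is feasible for the integer program, and `x₀` costs
no more than `y'`, hence no more than `y`.

The statements on inverse problems follow from this union, since each inverse-feasible region is
closed and contains `0`. -/

/-! ### Vectors supported on a basis -/

section Support

variable {S : Type*} [CommRing S] {m n : ℕ}

theorem mulVec_eq_submatrix_mulVec (M : Matrix (Fin m) (Fin n) S) {B : Finset (Fin n)}
    (hB : B.card = m) {s : Fin n → S} (hs : ∀ j, j ∉ B → s j = 0) :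
    M.mulVec s = (M.submatrix id (B.orderEmbOfFin hB)).mulVec (s ∘ B.orderEmbOfFin hB) := by
  ext i
  simp only [Matrix.mulVec, dotProduct]
  symm
  refine Fintype.sum_of_injective (B.orderEmbOfFin hB) (B.orderEmbOfFin hB).injective _ _ ?_ ?_
  · intro j hj
    rw [Finset.range_orderEmbOfFin] at hj
    rw [hs j (by simpa using hj), mul_zero]
  · intro k
    simp

/-- A vector indexed by the positions in `B`, extended by zero. -/
noncomputable def extendBasis {B : Finset (Fin n)} (hB : B.card = m) (t : Fin m → S) :
    Fin n → S :=
  Function.extend (B.orderEmbOfFin hB) t 0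

theorem extendBasis_comp {B : Finset (Fin n)} (hB : B.card = m) (t : Fin m → S) :
    extendBasis hB t ∘ B.orderEmbOfFin hB = t :=
  Function.extend_comp (B.orderEmbOfFin hB).injective t 0

theorem extendBasis_of_notMem {B : Finset (Fin n)} (hB : B.card = m) (t : Fin m → S) {j : Fin n}
    (hj : j ∉ B) : extendBasis hB t j = 0 := by
  unfold extendBasis
  rw [Function.extend_apply']
  · rfl
  · rintro ⟨a, rfl⟩
    exact hj (Finset.orderEmbOfFin_mem B hB a)

theorem mulVec_extendBasis (M : Matrix (Fin m) (Fin n) S) {B : Finset (Fin n)}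
    (hB : B.card = m) (t : Fin m → S) :
    M.mulVec (extendBasis hB t) = (M.submatrix id (B.orderEmbOfFin hB)).mulVec t := by
  rw [mulVec_eq_submatrix_mulVec M hB fun j hj => extendBasis_of_notMem hB t hj, extendBasis_comp]

theorem exists_orderEmbOfFin_eq {B : Finset (Fin n)} (hB : B.card = m) {j : Fin n} (hj : j ∈ B) :
    ∃ i, B.orderEmbOfFin hB i = j := by
  have : j ∈ Set.range (B.orderEmbOfFin hB) := by
    rw [Finset.range_orderEmbOfFin]; exact hj
  exact this

theorem eq_zero_of_comp_eq_zero {B : Finset (Fin n)} (hB : B.card = m) {s : Fin n → S}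
    (hs : ∀ j, j ∉ B → s j = 0) (h : s ∘ B.orderEmbOfFin hB = 0) : s = 0 := by
  ext j
  by_cases hj : j ∈ B
  · obtain ⟨i, rfl⟩ := exists_orderEmbOfFin_eq hB hj
    exact congrFun h i
  · exact hs j hj

end Support

/-! ### Column bases, pivots and basic feasible solutions -/

/-- The columns of `R` with index in `B` form a basis of `ℝᵐ`. -/
def IsColumnBasis {m n : ℕ} (R : Matrix (Fin m) (Fin n) ℝ) (B : Finset (Fin n)) : Prop :=
  B.card = m ∧ ∀ s : Fin n → ℝ, (∀ j, j ∉ B → s j = 0) → R.mulVec s = 0 → s = 0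

section Real

variable {m n : ℕ} {R : Matrix (Fin m) (Fin n) ℝ} {B : Finset (Fin n)}

/-- Exchange arguments are easier with vectors supported on `B`, which need no enumeration of `B`;
this is the bridge to determinants. -/
theorem isColumnBasis_iff_det_ne_zero (hB : B.card = m) :
    IsColumnBasis R B ↔ (R.submatrix id (B.orderEmbOfFin hB)).det ≠ 0 := by
  constructor
  · rintro ⟨-, h⟩ hdet
    obtain ⟨v, hv, hv0⟩ := Matrix.exists_mulVec_eq_zero_iff.mpr hdet
    apply hv
    rw [← extendBasis_comp hB v,
      h (extendBasis hB v) (fun j hj => extendBasis_of_notMem hB v hj)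
        (by rw [mulVec_extendBasis, hv0])]
    rfl
  · intro hdet
    refine ⟨hB, fun s hs h0 => eq_zero_of_comp_eq_zero hB hs ?_⟩
    rw [mulVec_eq_submatrix_mulVec R hB hs] at h0
    exact Matrix.eq_zero_of_mulVec_eq_zero hdet h0

theorem IsColumnBasis.eq_of_mulVec_eq (h : IsColumnBasis R B) {s t : Fin n → ℝ}
    (hs : ∀ j, j ∉ B → s j = 0) (ht : ∀ j, j ∉ B → t j = 0) (hst : R.mulVec s = R.mulVec t) :
    s = t := by
  refine sub_eq_zero.mp (h.2 (s - t) (fun j hj => by simp [hs j hj, ht j hj]) ?_)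
  rw [Matrix.mulVec_sub, hst, sub_self]

theorem IsColumnBasis.comp_eq_inv_mulVec (h : IsColumnBasis R B) (hB : B.card = m)
    {s : Fin n → ℝ} (hs : ∀ j, j ∉ B → s j = 0) :
    s ∘ B.orderEmbOfFin hB = (R.submatrix id (B.orderEmbOfFin hB))⁻¹.mulVec (R.mulVec s) := by
  have hdet := (isColumnBasis_iff_det_ne_zero hB).mp h
  rw [mulVec_eq_submatrix_mulVec R hB hs, Matrix.mulVec_mulVec,
    Matrix.nonsing_inv_mul _ (isUnit_iff_ne_zero.mpr hdet), Matrix.one_mulVec]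

theorem IsColumnBasis.exists_coords (h : IsColumnBasis R B) (v : Fin m → ℝ) :
    ∃ t : Fin n → ℝ, (∀ j, j ∉ B → t j = 0) ∧ R.mulVec t = v := by
  have hdet := (isColumnBasis_iff_det_ne_zero h.1).mp h
  refine ⟨extendBasis h.1 ((R.submatrix id (B.orderEmbOfFin h.1))⁻¹.mulVec v),
    fun j hj => extendBasis_of_notMem _ _ hj, ?_⟩
  rw [mulVec_extendBasis, Matrix.mulVec_mulVec,
    Matrix.mul_nonsing_inv _ (isUnit_iff_ne_zero.mpr hdet), Matrix.one_mulVec]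

/-- Exchange of a basic column for a nonbasic one. -/
theorem IsColumnBasis.exchange (h : IsColumnBasis R B) {j r : Fin n} (hj : j ∉ B) (hr : r ∈ B)
    {t : Fin n → ℝ} (ht : ∀ k, k ∉ B → t k = 0) (htj : R.mulVec t = R.mulVec (Pi.single j 1))
    (htr : t r ≠ 0) : IsColumnBasis R (insert j (B.erase r)) := by
  have hjr : j ≠ r := fun e => hj (e ▸ hr)
  constructor
  · rw [Finset.card_insert_of_notMem (by simp [hj]), Finset.card_erase_of_mem hr]
    have := Finset.card_pos.mpr ⟨r, hr⟩
    have := h.1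
    omega
  · intro s hs h0
    have hsr : s r = 0 := hs r (by simp [hjr.symm])
    -- Column `j` is replaced by its expansion `t`, which leaves a kernel vector supported on the
    -- old basis. Its entry at `r` is `s j * t r`.
    have key : s + s j • (t - Pi.single j 1) = 0 := by
      refine h.2 _ (fun k hk => ?_) ?_
      · by_cases hkj : k = j
        · subst hkj
          simp [ht k hk]
        · simp [hs k (by simp [hkj, hk]), ht k hk, hkj]
      · rw [Matrix.mulVec_add, Matrix.mulVec_smul, Matrix.mulVec_sub, htj, h0]
        simp
    have hsj : s j = 0 := by
      have := congrFun key r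
      simp only [Pi.add_apply, Pi.smul_apply, Pi.sub_apply, hsr, smul_eq_mul, Pi.zero_apply,
        Pi.single_eq_of_ne hjr.symm] at this
      have h2 : s j * t r = 0 := by linarith
      exact (mul_eq_zero.mp h2).resolve_right htr
    simpa [hsj] using key

/-- A simplex pivot at a nondegenerate basis strictly decreases the cost. -/
theorem IsColumnBasis.exists_pivot (h : IsColumnBasis R B) {d x t : Fin n → ℝ} {j : Fin n}
    (hx : ∀ k, k ∉ B → x k = 0) (hpos : ∀ k ∈ B, 0 < x k) (hj : j ∉ B)
    (ht : ∀ k, k ∉ B → t k = 0) (htj : R.mulVec t = R.mulVec (Pi.single j 1))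
    (hcost : d j < d ⬝ᵥ t) (htpos : ∃ r, 0 < t r) :
    ∃ (B' : Finset (Fin n)) (x' : Fin n → ℝ), IsColumnBasis R B' ∧ (∀ k, k ∉ B' → x' k = 0) ∧
      (∀ k, 0 ≤ x' k) ∧ R.mulVec x' = R.mulVec x ∧ d ⬝ᵥ x' < d ⬝ᵥ x := by
  classical
  obtain ⟨r₀, hr₀⟩ := htpos
  -- Ratio test: `r` is the first basic variable to reach zero as `j` increases. Nondegeneracy makes
  -- the step length `θ` positive.
  obtain ⟨r, hr, hmin⟩ := Finset.exists_min_image (Finset.univ.filter fun k => 0 < t k)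
    (fun k => x k / t k) ⟨r₀, by simpa using hr₀⟩
  simp only [Finset.mem_filter, Finset.mem_univ, true_and] at hr hmin
  have hrB : r ∈ B := by
    by_contra hc
    rw [ht r hc] at hr
    exact lt_irrefl _ hr
  have hjr : j ≠ r := fun e => hj (e ▸ hrB)
  set θ := x r / t r with hθ
  have hθpos : 0 < θ := div_pos (hpos r hrB) hr
  refine ⟨insert j (B.erase r), x + θ • (Pi.single j 1 - t),
    h.exchange hj hrB ht htj hr.ne', ?_, ?_, ?_, ?_⟩
  · intro k hk
    simp only [Finset.mem_insert, Finset.mem_erase, not_or, not_and] at hk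
    obtain ⟨hkj, hk⟩ := hk
    by_cases hkr : k = r
    · subst hkr
      simp only [Pi.add_apply, Pi.smul_apply, Pi.sub_apply, Pi.single_eq_of_ne hkj, smul_eq_mul]
      rw [hθ]
      field_simp
      ring
    · simp [hx k (hk hkr), ht k (hk hkr), hkj]
  · intro k
    by_cases hkB : k ∈ B
    · have hkj : k ≠ j := fun e => hj (e ▸ hkB)
      simp only [Pi.add_apply, Pi.smul_apply, Pi.sub_apply, Pi.single_eq_of_ne hkj, smul_eq_mul]
      rcases le_or_gt (t k) 0 with htk | htk
      · nlinarith [hpos k hkB]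
      · have := (le_div_iff₀ htk).mp (hmin k htk)
        linarith
    · by_cases hkj : k = j
      · subst hkj
        simp [hx k hkB, ht k hkB, hθpos.le]
      · simp [hx k hkB, ht k hkB, hkj]
  · rw [Matrix.mulVec_add, Matrix.mulVec_smul, Matrix.mulVec_sub, htj]
    simp
  · rw [dotProduct_add, dotProduct_smul, dotProduct_sub, dotProduct_single, smul_eq_mul]
    nlinarith

/-- The cost difference of two solutions in terms of the reduced costs. -/
theorem IsColumnBasis.dotProduct_eq_sum_reducedCost (h : IsColumnBasis R B) {d z : Fin n → ℝ}
    {T : Fin n → Fin n → ℝ} (hT : ∀ j k, k ∉ B → T j k = 0)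
    (hTj : ∀ j, R.mulVec (T j) = R.mulVec (Pi.single j 1)) (hz : R.mulVec z = 0) :
    d ⬝ᵥ z = ∑ j, z j * (d j - d ⬝ᵥ T j) := by
  -- This combination is supported on `B` and has the same image as `z`, namely zero.
  have key : ∑ j, z j • T j = 0 := by
    refine h.2 _ (fun k hk => by simp [hT _ k hk]) ?_
    rw [Matrix.mulVec_sum]
    simp_rw [Matrix.mulVec_smul, hTj]
    rw [← hz]
    simp_rw [← Matrix.mulVec_smul]
    rw [← Matrix.mulVec_sum]
    congr 1
    ext k
    simp [Finset.sum_apply, Pi.single_apply]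
  have h2 : ∑ j, z j * (d ⬝ᵥ T j) = 0 := by
    have := congrArg (fun v => d ⬝ᵥ v) key
    simpa [dotProduct_sum, dotProduct_smul] using this
  simp_rw [mul_sub]
  rw [Finset.sum_sub_distrib, h2, sub_zero]
  exact Finset.sum_congr rfl fun j _ => mul_comm _ _

/-- Every feasible linear program in standard form has a basic feasible solution. -/
theorem exists_isColumnBasis_nonneg (hR : R.rank = m) {x : Fin n → ℝ} (hx : ∀ k, 0 ≤ x k) :
    ∃ (B : Finset (Fin n)) (y : Fin n → ℝ), IsColumnBasis R B ∧ (∀ k, k ∉ B → y k = 0) ∧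
      (∀ k, 0 ≤ y k) ∧ R.mulVec y = R.mulVec x := by
  classical
  -- a nonnegative solution of minimal support
  obtain ⟨y, ⟨hy0, hyx⟩, hymin⟩ := (measure fun y : Fin n → ℝ =>
      (Finset.univ.filter fun k => y k ≠ 0).card).wf.has_min
    {y | (∀ k, 0 ≤ y k) ∧ R.mulVec y = R.mulVec x} ⟨x, hx, rfl⟩
  -- A kernel vector inside the support of `y` with a positive entry would allow a ratio step that
  -- stays nonnegative and shrinks the support.
  have aux : ∀ s : Fin n → ℝ, (∀ k, y k = 0 → s k = 0) → R.mulVec s = 0 → ∀ r, ¬ 0 < s r := by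
    intro s hs hs0 r₀ hr₀
    obtain ⟨r, hr, hmin⟩ := Finset.exists_min_image (Finset.univ.filter fun k => 0 < s k)
      (fun k => y k / s k) ⟨r₀, by simpa using hr₀⟩
    simp only [Finset.mem_filter, Finset.mem_univ, true_and] at hr hmin
    set θ := y r / s r with hθ
    have hθ0 : 0 ≤ θ := div_nonneg (hy0 r) hr.le
    refine hymin (y - θ • s) ⟨fun k => ?_, ?_⟩ ?_
    · simp only [Pi.sub_apply, Pi.smul_apply, smul_eq_mul]
      rcases le_or_gt (s k) 0 with hk | hk
      · nlinarith [hy0 k]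
      · have := (le_div_iff₀ hk).mp (hmin k hk)
        linarith
    · rw [Matrix.mulVec_sub, Matrix.mulVec_smul, hs0, hyx]
      simp
    · refine Finset.card_lt_card ?_
      rw [Finset.ssubset_iff_of_subset]
      · refine ⟨r, ?_, ?_⟩
        · simp only [Finset.mem_filter, Finset.mem_univ, true_and]
          exact fun e => hr.ne' (hs r e)
        · simp only [Finset.mem_filter, Finset.mem_univ, true_and, not_not, Pi.sub_apply,
            Pi.smul_apply, smul_eq_mul]
          rw [hθ]
          field_simp
          ring
      · intro k hk
        simp only [Finset.mem_filter, Finset.mem_univ, true_and] at hk ⊢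
        intro e
        exact hk (by simp [e, hs k e])
  have hind : ∀ s : Fin n → ℝ, (∀ k, y k = 0 → s k = 0) → R.mulVec s = 0 → s = 0 := by
    intro s hs hs0
    ext k
    have h1 := aux s hs hs0 k
    have h2 := aux (-s) (fun k hk => by simp [hs k hk]) (by rw [Matrix.mulVec_neg, hs0, neg_zero]) k
    simp only [Pi.neg_apply] at h2
    have h3 : s k = 0 := by linarith
    exact h3
  -- extend the support to a basis
  have hli : LinearIndepOn ℝ R.col {k | y k ≠ 0} := by
    rw [linearIndepOn_iff']
    intro u g hu hg i hi
    have := hind (fun k => if k ∈ u then g k else 0) (fun k hk => by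
      rw [if_neg]
      exact fun hc => hu hc hk) (by
      rw [← hg]
      ext i
      simp [Matrix.mulVec, dotProduct, Finset.sum_apply, mul_comm])
    simpa [hi] using congrFun this i
  obtain ⟨b, -, hyb, hspan, hb⟩ := exists_linearIndepOn_extension hli (Set.subset_univ _)
  -- Full row rank makes the columns span, so the extended set has exactly `m` elements.
  have htop : Submodule.span ℝ (R.col '' b) = ⊤ := by
    have h1 : Submodule.span ℝ (Set.range R.col) = ⊤ := by
      apply Submodule.eq_top_of_finrank_eq
      rw [← Matrix.rank_eq_finrank_span_cols, hR]
      simp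
    rw [eq_top_iff, ← h1]
    exact Submodule.span_le.mpr (by simpa using hspan)
  refine ⟨b.toFinset, y, ⟨?_, ?_⟩, ?_, hy0, hyx⟩
  · have h3 : LinearIndependent ℝ fun k : b => R.col k := hb
    have h4 := finrank_span_eq_card h3
    have h5 : Set.range (fun k : b => R.col k) = R.col '' b := by
      ext; simp
    rw [h5, htop] at h4
    rw [Set.toFinset_card, ← h4]
    simp
  · intro s hs hs0
    rw [linearIndepOn_iff'] at hb
    have := hb b.toFinset s (by simp) (by
      rw [← hs0]
      ext i
      simp only [Finset.sum_apply, Matrix.mulVec, dotProduct, Pi.smul_apply, smul_eq_mul,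
        Matrix.col_apply]
      rw [Finset.sum_subset (Finset.subset_univ _)]
      · exact Finset.sum_congr rfl fun k _ => mul_comm _ _
      · intro k _ hk
        rw [hs k hk, zero_mul])
    ext k
    by_cases hk : k ∈ b.toFinset
    · exact this k hk
    · exact hs k hk
  · intro k hk
    by_contra hc
    exact hk (by simpa using hyb hc)

end Real

/-! ### The group relaxation -/

section Group

/-- A vector of multiplicities with total at least the order of a finite group dominates a nonzero
vector of multiplicities whose weighted sum of group elements vanishes. -/
theorem exists_le_sum_nsmul_eq_zero {ι G : Type*} [Fintype ι] [DecidableEq ι] [AddCommGroup G]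
    [Finite G] (g : ι → G) (v : ι → ℕ) (hv : Nat.card G ≤ ∑ i, v i) :
    ∃ u : ι → ℕ, u ≤ v ∧ u ≠ 0 ∧ ∑ i, u i • g i = 0 := by
  set l : List ι := (∑ i, Multiset.replicate (v i) i : Multiset ι).toList with hl
  have hcount : ∀ i, l.count i = v i := by
    intro i
    rw [hl, ← Multiset.coe_count, Multiset.coe_toList, Multiset.count_sum']
    simp [Multiset.count_replicate]
  have hlen : l.length = ∑ i, v i := by
    rw [hl, Multiset.length_toList]
    simp
  have : Fintype G := Fintype.ofFinite G
  have hcard : Fintype.card G < Fintype.card (Fin (Nat.card G + 1)) := by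
    simp [Nat.card_eq_fintype_card]
  -- The prefixes of `l` of lengths `0, …, |G|` give `|G| + 1` partial sums, so two agree; the
  -- segment between them sums to zero.
  obtain ⟨a, c, hac, heq⟩ := Fintype.exists_ne_map_eq_of_card_lt
    (fun k : Fin (Nat.card G + 1) => ∑ i, ((l.take k).count i) • g i) hcard
  wlog hlt : a < c generalizing a c
  · exact this c a hac.symm heq.symm (lt_of_le_of_ne (not_lt.mp hlt) hac.symm)
  have hle : ∀ i, (l.take a).count i ≤ (l.take c).count i := fun i =>
    (List.take_sublist_take_left hlt.le).count_le i
  refine ⟨fun i => (l.take c).count i - (l.take a).count i, fun i => ?_, fun h0 => ?_, ?_⟩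
  · have := (List.take_sublist c.val l).count_le i
    have := hcount i
    simp only
    omega
  · have h1 : (l.take a).length = (l.take c).length := by
      have hs : ∀ l' : List ι, ∑ i, l'.count i = l'.length := by
        intro l'
        have := Multiset.toFinset_sum_count_eq (l' : Multiset ι)
        simp only [Multiset.coe_count, Multiset.coe_card] at this
        rw [← this]
        symm
        refine Finset.sum_subset (Finset.subset_univ _) fun i _ hi => ?_
        exact List.count_eq_zero_of_not_mem (by simpa using hi)
      rw [← hs, ← hs]
      refine Finset.sum_congr rfl fun i _ => ?_
      have h2 := congrFun h0 i
      simp only [Pi.zero_apply] at h2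
      have := hle i
      omega
    rw [List.length_take, List.length_take] at h1
    have := c.2
    have : a.val < c.val := hlt
    omega
  · have h3 : ∀ i, ((l.take c).count i - (l.take a).count i) • g i =
        (l.take c).count i • g i - (l.take a).count i • g i := by
      intro i
      rw [eq_sub_iff_add_eq, ← add_smul, Nat.sub_add_cancel (hle i)]
    simp_rw [h3]
    rw [Finset.sum_sub_distrib, heq, sub_self]

/-- Nonsingularity identifies `ℤᵐ` with the image lattice, whose index is then the absolute
determinant of that map. -/
theorem card_quotient_range_mulVecLin {m : ℕ} (M : Matrix (Fin m) (Fin m) ℤ) (hM : M.det ≠ 0) :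
    Nat.card ((Fin m → ℤ) ⧸ LinearMap.range M.mulVecLin) = M.det.natAbs := by
  have hinj : Function.Injective M.mulVecLin := by
    rw [← LinearMap.ker_eq_bot, LinearMap.ker_eq_bot']
    intro v hv
    exact Matrix.eq_zero_of_mulVec_eq_zero hM hv
  rw [← Submodule.natAbs_det_equiv _ (LinearEquiv.ofInjective M.mulVecLin hinj)]
  rw [← LinearMap.det_toLin' M]
  congr 2

end Group

/-! ### Reducing the nonbasic part of a corner-feasible point -/

section Corner

variable {m n : ℕ} {A : Matrix (Fin m) (Fin n) ℤ} {b : Fin m → ℤ} {B : Finset (Fin n)}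

theorem realMatrix_mulVec (A : Matrix (Fin m) (Fin n) ℤ) (x : Fin n → ℤ) :
    (realMatrix A).mulVec (realVec x) = realVec (A.mulVec x) := by
  ext i
  simp [realMatrix, realVec, Matrix.mulVec, dotProduct]

theorem realVec_add {k : ℕ} (x y : Fin k → ℤ) : realVec (x + y) = realVec x + realVec y := by
  ext; simp [realVec]

theorem cost_add (d : Fin n → ℝ) (x z : Fin n → ℤ) : cost d (x + z) = cost d x + cost d z := by
  rw [cost, realVec_add, dotProduct_add]; rfl

theorem det_basisMatrix (A : Matrix (Fin m) (Fin n) ℤ) (hB : B.card = m) :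
    (basisMatrix A B hB).det = ((A.submatrix id (B.orderEmbOfFin hB)).det : ℤ) := by
  have := (Int.castRingHom ℝ).map_det (A.submatrix id (B.orderEmbOfFin hB))
  simp only [eq_intCast] at this
  rw [this]
  rfl

theorem abs_det_basisMatrix (A : Matrix (Fin m) (Fin n) ℤ) (hB : B.card = m) :
    |(basisMatrix A B hB).det| = ((A.submatrix id (B.orderEmbOfFin hB)).det.natAbs : ℝ) := by
  rw [det_basisMatrix, Nat.cast_natAbs, Int.cast_abs]

theorem isColumnBasis_iff_det_basisMatrix_ne_zero (hB : B.card = m) :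
    IsColumnBasis (realMatrix A) B ↔ (basisMatrix A B hB).det ≠ 0 :=
  isColumnBasis_iff_det_ne_zero hB

theorem IsColumnBasis.intDet_ne_zero (h : IsColumnBasis (realMatrix A) B) :
    (A.submatrix id (B.orderEmbOfFin h.1)).det ≠ 0 := by
  have := (isColumnBasis_iff_det_basisMatrix_ne_zero h.1).mp h
  rw [det_basisMatrix] at this
  exact_mod_cast this

/-- Corner feasible points can be improved to ones whose nonbasic part is bounded by the
determinant of the basis. -/
theorem exists_gcrFeasible_sum_lt (h : IsColumnBasis (realMatrix A) B) {d : Fin n → ℝ}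
    {T : Fin n → Fin n → ℝ} (hT : ∀ j k, k ∉ B → T j k = 0)
    (hTj : ∀ j, (realMatrix A).mulVec (T j) = (realMatrix A).mulVec (Pi.single j 1))
    (hred : ∀ j, j ∉ B → d ⬝ᵥ T j ≤ d j) :
    ∀ (N : ℕ) (y : Fin n → ℤ), y ∈ gcrFeasible A b B →
      ∑ j ∈ Bᶜ, (y j).toNat = N → ∃ y' ∈ gcrFeasible A b B, cost d y' ≤ cost d y ∧
        ∑ j ∈ Bᶜ, (y' j).toNat < (A.submatrix id (B.orderEmbOfFin h.1)).det.natAbs := by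
  intro N
  induction N using Nat.strong_induction_on with
  | _ N ih =>
  intro y hy hN
  set M := A.submatrix id (B.orderEmbOfFin h.1) with hM
  by_cases hlt : ∑ j ∈ Bᶜ, (y j).toNat < M.det.natAbs
  · exact ⟨y, hy, le_rfl, hlt⟩
  have hcard := card_quotient_range_mulVecLin M h.intDet_ne_zero
  have hfin : Finite ((Fin m → ℤ) ⧸ LinearMap.range M.mulVecLin) := by
    apply Nat.finite_of_card_ne_zero
    rw [hcard]
    exact Int.natAbs_ne_zero.mpr h.intDet_ne_zero
  have hsum : ∑ j, (if j ∈ Bᶜ then (y j).toNat else 0) = ∑ j ∈ Bᶜ, (y j).toNat := by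
    rw [← Finset.sum_filter]; congr 1; ext; simp
  obtain ⟨u, huv, hu0, hu⟩ := exists_le_sum_nsmul_eq_zero
    (fun j => (LinearMap.range M.mulVecLin).mkQ (A.mulVec (Pi.single j 1)))
    (fun j => if j ∈ Bᶜ then (y j).toNat else 0) (by rw [hcard, hsum]; exact not_lt.mp hlt)
  have huB : ∀ j ∈ B, u j = 0 := by
    intro j hj
    have := huv j
    simpa [hj] using this
  have huN : ∀ j, j ∉ B → u j ≤ (y j).toNat := by
    intro j hj
    have := huv j
    simpa [hj] using this
  have hmem : A.mulVec (fun j => (u j : ℤ)) ∈ LinearMap.range M.mulVecLin := by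
    rw [← Submodule.Quotient.mk_eq_zero, ← Submodule.mkQ_apply, ← hu]
    simp_rw [← map_nsmul]
    rw [← map_sum]
    congr 1
    simp_rw [← Matrix.mulVec_smul]
    rw [← Matrix.mulVec_sum]
    congr 1
    ext k
    simp [Finset.sum_apply, Pi.single_apply]
  obtain ⟨w, hw⟩ := hmem
  rw [Matrix.mulVecLin_apply] at hw
  -- The exchange direction removes the multiplicities `u` from the nonbasic variables and restores
  -- `A y = b` through the integral basic vector `w`.
  set z : Fin n → ℤ := extendBasis h.1 w - fun j => (u j : ℤ) with hz
  have hzN : ∀ j, j ∉ B → z j = -(u j : ℤ) := by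
    intro j hj
    simp [hz, extendBasis_of_notMem h.1 w hj]
  have hAz : A.mulVec z = 0 := by
    rw [hz, Matrix.mulVec_sub, mulVec_extendBasis, ← hM, hw, sub_self]
  have hcost : cost d z ≤ 0 := by
    -- Only nonbasic terms survive, since basic columns have zero reduced cost; there `z j = -u j ≤
    -- 0` meets a nonnegative reduced cost.
    rw [cost, h.dotProduct_eq_sum_reducedCost hT hTj (by
      rw [realMatrix_mulVec, hAz]; ext; simp [realVec])]
    refine Finset.sum_nonpos fun j _ => ?_
    by_cases hj : j ∈ B
    · have : T j = Pi.single j 1 := h.eq_of_mulVec_eq (hT j)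
        (fun k hk => Pi.single_eq_of_ne (fun e : k = j => hk (e.symm ▸ hj)) _) (hTj j)
      simp [this]
    · refine mul_nonpos_of_nonpos_of_nonneg ?_ (sub_nonneg.mpr (hred j hj))
      simp [realVec, hzN j hj]
  have hyz : y + z ∈ gcrFeasible A b B := by
    refine ⟨by rw [Matrix.mulVec_add, hAz, add_zero, hy.1], fun j hj => ?_⟩
    have h1 := huN j hj
    have h2 := hy.2 j hj
    rw [Pi.add_apply, hzN j hj]
    omega
  obtain ⟨j₀, hj₀⟩ := Function.ne_iff.mp hu0
  have hj₀B : j₀ ∉ B := fun hc => hj₀ (huB j₀ hc)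
  have hless : ∑ j ∈ Bᶜ, ((y + z) j).toNat < N := by
    rw [← hN]
    refine Finset.sum_lt_sum (fun j hj => ?_) ⟨j₀, by simpa using hj₀B, ?_⟩
    · rw [Pi.add_apply, hzN j (by simpa using hj)]
      omega
    · have h1 := huN j₀ hj₀B
      rw [Pi.add_apply, hzN j₀ hj₀B]
      simp only [Pi.zero_apply] at hj₀
      omega
  obtain ⟨y', hy', hc, hs⟩ := ih _ hless (y + z) hyz rfl
  exact ⟨y', hy', by rw [cost_add] at hc; linarith, hs⟩

end Corner

/-! ### The geometry of the basis cone -/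

section Cone

/-- A segment avoiding the frontier would be covered by the disjoint open sets `interior s` and
`interior sᶜ`, against connectedness. -/
theorem exists_mem_segment_frontier {E : Type*} [NormedAddCommGroup E] [NormedSpace ℝ E]
    {s : Set E} {x y : E} (hx : x ∈ s) (hy : y ∉ s) : ∃ z ∈ segment ℝ x y, z ∈ frontier s := by
  by_contra! hc
  have hsub : segment ℝ x y ⊆ interior s ∪ interior sᶜ := by
    intro z hz
    have := hc z hz
    rw [frontier, Set.mem_sdiff, not_and_not_right] at this
    by_cases h : z ∈ closure s
    · exact Or.inl (this h)
    · right; rwa [interior_compl]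
  have hdisj : Disjoint (interior s) (interior sᶜ) :=
    (disjoint_compl_right (a := s)).mono interior_subset interior_subset
  have hpre : IsPreconnected (segment ℝ x y) := (convex_segment x y).isPreconnected
  have hxs : x ∈ interior s := by
    rcases hsub (left_mem_segment ℝ x y) with h | h
    · exact h
    · exact absurd hx (interior_subset h)
  exact hy (interior_subset (hpre.subset_left_of_subset_union isOpen_interior isOpen_interior hdisj
    hsub ⟨x, left_mem_segment ℝ x y, hxs⟩ (right_mem_segment ℝ x y)))

variable {m n : ℕ} {A : Matrix (Fin m) (Fin n) ℤ} {b : Fin m → ℤ} {B : Finset (Fin n)}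

/-- The entries of `s` on `B` are the coordinates `A_B⁻¹ (A s)`, so the inverse matrix need not
appear in later cone arguments. -/
theorem mem_basisCone_iff (h : IsColumnBasis (realMatrix A) B) (hB : B.card = m) {s : Fin n → ℝ}
    (hs : ∀ j, j ∉ B → s j = 0) :
    (WithLp.toLp 2 ((realMatrix A).mulVec s) : EuclideanSpace ℝ (Fin m)) ∈ basisCone A B hB ↔
      ∀ k, 0 ≤ s k := by
  have key := h.comp_eq_inv_mulVec hB hs
  simp only [basisCone, Set.mem_ofPred_eq, basisMatrix]
  rw [← key]
  constructor
  · intro h0 k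
    by_cases hk : k ∈ B
    · obtain ⟨i, rfl⟩ := exists_orderEmbOfFin_eq hB hk
      exact h0 i
    · exact (hs k hk).ge
  · exact fun h0 i => h0 _

theorem mem_feasibleBases_iff :
    B ∈ feasibleBases A b ↔ IsColumnBasis (realMatrix A) B ∧
      ∃ s : Fin n → ℝ, (∀ j, j ∉ B → s j = 0) ∧ (∀ j, 0 ≤ s j) ∧
        (realMatrix A).mulVec s = realVec b := by
  constructor
  · rintro ⟨hB, hdet, h0⟩
    have h := (isColumnBasis_iff_det_basisMatrix_ne_zero hB).mpr hdet
    obtain ⟨s, hs, hsb⟩ := h.exists_coords (realVec b)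
    refine ⟨h, s, hs, ?_, hsb⟩
    rw [← mem_basisCone_iff h hB hs, hsb]
    exact h0
  · rintro ⟨h, s, hs, h0, hsb⟩
    refine ⟨h.1, (isColumnBasis_iff_det_basisMatrix_ne_zero h.1).mp h, ?_⟩
    rw [← mem_basisCone_iff h h.1 hs, hsb] at h0
    exact h0

theorem columnNorm_nonneg (A : Matrix (Fin m) (Fin n) ℤ) (j : Fin n) : 0 ≤ columnNorm A j :=
  norm_nonneg _

theorem columnNorm_le_iSup {j : Fin n} (hj : j ∉ B) :
    columnNorm A j ≤ ⨆ j : {j : Fin n // j ∉ B}, columnNorm A j :=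
  le_ciSup (f := fun j : {j : Fin n // j ∉ B} => columnNorm A j) (Set.finite_range _).bddAbove
    ⟨j, hj⟩

/-- Under Gomory's condition, a basic solution is nondegenerate as soon as some nonbasic column is
nonzero. -/
theorem pos_of_gomoryCondition (h : IsColumnBasis (realMatrix A) B) (hB : B.card = m)
    (hG : GomoryCondition A b B hB) {s : Fin n → ℝ} (hs : ∀ k, k ∉ B → s k = 0)
    (h0 : ∀ k, 0 ≤ s k) (hsb : (realMatrix A).mulVec s = realVec b) {j : Fin n} (hj : j ∉ B)
    (hAj : (realMatrix A).mulVec (Pi.single j 1) ≠ 0) : ∀ k ∈ B, 0 < s k := by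
  intro k hk
  refine lt_of_le_of_ne (h0 k) fun hsk => ?_
  have hfr : (WithLp.toLp 2 (realVec b) : EuclideanSpace ℝ (Fin m)) ∈
      frontier (basisCone A B hB) := by
    rw [frontier_eq_closure_inter_closure]
    constructor
    · apply subset_closure
      rw [← hsb]
      exact (mem_basisCone_iff h hB hs).mpr h0
    -- Lowering the zero coordinate `k` by `ε > 0` leaves the cone, and these points tend to `b`.
    · let f : ℝ → EuclideanSpace ℝ (Fin m) := fun ε =>
        WithLp.toLp 2 ((realMatrix A).mulVec (s - ε • Pi.single k 1))
      have hf : Continuous f := by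
        refine (PiLp.continuous_toLp 2 _).comp ?_
        refine Continuous.matrix_mulVec continuous_const ?_
        fun_prop
      have hf0 : f 0 = WithLp.toLp 2 (realVec b) := by simp [f, hsb]
      rw [← hf0]
      refine mem_closure_of_tendsto
        ((hf.tendsto 0).mono_left (nhdsWithin_le_nhds (s := Set.Ioi (0 : ℝ)))) ?_
      filter_upwards [self_mem_nhdsWithin] with ε hε
      intro hc
      rw [mem_basisCone_iff h hB (fun i hi => by
        have : i ≠ k := fun e => hi (e ▸ hk)
        simp [hs i hi, this])] at hc
      have := hc k
      simp only [Pi.sub_apply, ← hsk, Pi.smul_apply, Pi.single_eq_same, smul_eq_mul] at this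
      have : (0 : ℝ) < ε := hε
      linarith
  have h1 : |(basisMatrix A B hB).det| * (⨆ j : {j : Fin n // j ∉ B}, columnNorm A j) ≤ 0 := by
    rw [← Metric.infDist_zero_of_mem hfr]
    exact hG
  have h2 : 0 < |(basisMatrix A B hB).det| :=
    abs_pos.mpr ((isColumnBasis_iff_det_basisMatrix_ne_zero hB).mp h)
  have h3 : 0 < columnNorm A j := by
    refine norm_pos_iff.mpr fun hc => hAj ?_
    have := congrArg WithLp.ofLp hc
    simp only [WithLp.ofLp_zero] at this
    rw [Matrix.mulVec_single_one]
    exact this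
  have := columnNorm_le_iSup (A := A) hj
  nlinarith

/-- Under Gomory's condition, a corner feasible point with small nonbasic part is nonnegative. -/
theorem mem_ipFeasible_of_gomoryCondition (h : IsColumnBasis (realMatrix A) B)
    (hG : GomoryCondition A b B h.1) {s : Fin n → ℝ} (hs : ∀ k, k ∉ B → s k = 0)
    (h0 : ∀ k, 0 ≤ s k) (hsb : (realMatrix A).mulVec s = realVec b)
    {y : Fin n → ℤ} (hy : y ∈ gcrFeasible A b B)
    (hlt : ∑ j ∈ Bᶜ, (y j).toNat < (A.submatrix id (B.orderEmbOfFin h.1)).det.natAbs) :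
    y ∈ ipFeasible A b := by
  classical
  refine ⟨hy.1, ?_⟩
  let yB : Fin n → ℝ := fun j => if j ∈ B then (y j : ℝ) else 0
  have hyB : ∀ k, k ∉ B → yB k = 0 := fun k hk => if_neg hk
  suffices hmem : (WithLp.toLp 2 ((realMatrix A).mulVec yB) : EuclideanSpace ℝ (Fin m)) ∈
      basisCone A B h.1 by
    intro i
    by_cases hi : i ∈ B
    · have := (mem_basisCone_iff h h.1 hyB).mp hmem i
      simp only [yB, if_pos hi] at this
      exact_mod_cast this
    · exact hy.2 i hi
  by_contra hnot
  have hbmem : (WithLp.toLp 2 (realVec b) : EuclideanSpace ℝ (Fin m)) ∈ basisCone A B h.1 := by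
    rw [← hsb]
    exact (mem_basisCone_iff h h.1 hs).mpr h0
  set M := ⨆ j : {j : Fin n // j ∉ B}, columnNorm A j with hM
  have hM0 : 0 ≤ M := Real.iSup_nonneg fun j => columnNorm_nonneg A j
  set S : ℕ := ∑ j ∈ Bᶜ, (y j).toNat with hS
  -- The displacement from `b` is the sum of the nonbasic columns taken with multiplicity, hence has
  -- norm at most `S * M`.
  have hdiff : (WithLp.toLp 2 (realVec b) : EuclideanSpace ℝ (Fin m)) -
      WithLp.toLp 2 ((realMatrix A).mulVec yB) =
      ∑ j ∈ Bᶜ, ((y j).toNat : ℝ) • (WithLp.toLp 2 (fun i => realMatrix A i j) :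
        EuclideanSpace ℝ (Fin m)) := by
    rw [← hy.1, ← realMatrix_mulVec]
    ext i
    simp only [PiLp.sub_apply, Matrix.mulVec, dotProduct, WithLp.ofLp_sum, Finset.sum_apply,
      PiLp.smul_apply, smul_eq_mul]
    rw [← Finset.sum_sub_distrib, ← Finset.sum_subset (Finset.subset_univ Bᶜ)]
    · refine Finset.sum_congr rfl fun j hj => ?_
      have hj' : j ∉ B := by simpa using hj
      have : ((y j).toNat : ℝ) = (y j : ℝ) := by
        exact_mod_cast Int.toNat_of_nonneg (hy.2 j hj')
      simp only [yB, if_neg hj', this, realVec]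
      ring
    · intro j _ hj
      have hj' : j ∈ B := by simpa using hj
      simp [yB, hj', realVec]
  have hdist : dist (WithLp.toLp 2 (realVec b) : EuclideanSpace ℝ (Fin m))
      (WithLp.toLp 2 ((realMatrix A).mulVec yB)) ≤ S * M := by
    rw [dist_eq_norm, hdiff, hS, Nat.cast_sum, Finset.sum_mul]
    refine norm_sum_le_of_le _ fun j hj => ?_
    rw [norm_smul, Real.norm_natCast]
    exact mul_le_mul_of_nonneg_left (columnNorm_le_iSup (by simpa using hj)) (Nat.cast_nonneg _)
  obtain ⟨z, hz, hzf⟩ := exists_mem_segment_frontier hbmem hnot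
  have h1 := dist_add_dist_of_mem_segment hz
  have h2 := Metric.infDist_le_dist_of_mem (x := (WithLp.toLp 2 (realVec b) :
    EuclideanSpace ℝ (Fin m))) hzf
  have h3 : ((A.submatrix id (B.orderEmbOfFin h.1)).det.natAbs : ℝ) * M ≤
      Metric.infDist (WithLp.toLp 2 (realVec b) : EuclideanSpace ℝ (Fin m))
        (frontier (basisCone A B h.1)) := by
    rw [← abs_det_basisMatrix]
    exact hG
  -- Integrality gains a full unit. Leaving the cone would give `(S + 1) * M ≤ S * M`, so `M = 0`;
  -- but then the point coincides with `b`, which is in the cone.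
  have h4 : (S : ℝ) + 1 ≤ ((A.submatrix id (B.orderEmbOfFin h.1)).det.natAbs : ℝ) := by
    exact_mod_cast hlt
  have h5 := dist_nonneg (x := z) (y := (WithLp.toLp 2 ((realMatrix A).mulVec yB) :
    EuclideanSpace ℝ (Fin m)))
  have hM1 : M = 0 := by nlinarith
  rw [hM1, mul_zero] at hdist
  exact hnot (dist_le_zero.mp hdist ▸ hbmem)

end Cone

/-! ### Optimal bases and the inverse-feasible regions -/

section Optimal

variable {m n : ℕ} {A : Matrix (Fin m) (Fin n) ℤ} {b : Fin m → ℤ} {B : Finset (Fin n)}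

theorem ipFeasible_subset_gcrFeasible : ipFeasible A b ⊆ gcrFeasible A b B :=
  fun _ hx => ⟨hx.1, fun i _ => hx.2 i⟩

theorem inverseFeasible_anti {F G : Set (Fin n → ℤ)} (hFG : F ⊆ G) {x : Fin n → ℤ} (hx : x ∈ F) :
    inverseFeasible G x ⊆ inverseFeasible F x :=
  fun _ hd => ⟨hx, fun y hy => hd.2 y (hFG hy)⟩

/-- If the integer program has an optimal solution, then no nonbasic column with negative reduced
cost generates a ray of the linear relaxation. -/
theorem exists_coord_pos_of_optimal (h : IsColumnBasis (realMatrix A) B) {d t : Fin n → ℝ}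
    {x₀ : Fin n → ℤ} (hopt : IsOptimalSolution (ipFeasible A b) d x₀) {j : Fin n}
    (ht : ∀ k, k ∉ B → t k = 0)
    (htj : (realMatrix A).mulVec t = (realMatrix A).mulVec (Pi.single j 1))
    (hcost : d j < d ⬝ᵥ t) : ∃ r, 0 < t r := by
  by_contra! hneg
  set M := A.submatrix id (B.orderEmbOfFin h.1) with hM
  have hdet : M.det ≠ 0 := h.intDet_ne_zero
  -- By Cramer's rule the adjugate clears denominators: `w` is the integral vector `det • t`.
  set w : Fin n → ℤ := extendBasis h.1 (M.adjugate.mulVec (A.mulVec (Pi.single j 1))) with hw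
  have hAw : A.mulVec w = M.det • A.mulVec (Pi.single j 1) := by
    rw [hw, mulVec_extendBasis, ← hM, Matrix.mulVec_mulVec, Matrix.mul_adjugate,
      Matrix.smul_mulVec, Matrix.one_mulVec]
  have hwt : realVec w = (M.det : ℝ) • t := by
    refine h.eq_of_mulVec_eq (fun k hk => ?_) (fun k hk => by simp [ht k hk]) ?_
    · simp [realVec, hw, extendBasis_of_notMem h.1 _ hk]
    · have hsing : realVec (Pi.single j (1 : ℤ)) = (Pi.single j 1 : Fin n → ℝ) := by
        ext k
        by_cases hk : k = j
        · subst hk; simp [realVec]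
        · simp [realVec, hk]
      rw [Matrix.mulVec_smul, htj, realMatrix_mulVec, hAw, ← hsing, realMatrix_mulVec]
      ext i
      simp [realVec]
  -- This is `det² • (e_j - t)`; squaring makes the multiple positive whatever the sign of the
  -- determinant.
  set z : Fin n → ℤ := M.det ^ 2 • Pi.single j 1 - M.det • w with hz
  have hzr : realVec z = (M.det : ℝ) ^ 2 • (Pi.single j 1 - t) := by
    ext k
    have hk := congrFun hwt k
    simp only [realVec, Pi.smul_apply, smul_eq_mul] at hk
    simp only [realVec, hz, Pi.sub_apply, Pi.smul_apply, smul_eq_mul, Int.cast_sub, Int.cast_mul,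
      Int.cast_pow, hk]
    by_cases hkj : k = j
    · subst hkj
      simp only [Pi.single_eq_same, Int.cast_one]
      ring
    · simp only [Pi.single_eq_of_ne hkj, Int.cast_zero]
      ring
  have hpos : (0 : ℝ) < (M.det : ℝ) ^ 2 := by positivity
  have hz0 : ∀ k, 0 ≤ z k := by
    intro k
    have h1 := congrFun hzr k
    simp only [realVec, Pi.smul_apply, Pi.sub_apply, smul_eq_mul] at h1
    have h2 : (0 : ℝ) ≤ (Pi.single j 1 : Fin n → ℝ) k := by
      by_cases hk : k = j
      · subst hk; simp
      · simp [hk]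
    have h3 : (0 : ℝ) ≤ (z k : ℝ) := by
      rw [h1]
      exact mul_nonneg hpos.le (by linarith [hneg k])
    exact_mod_cast h3
  have hfeas : x₀ + z ∈ ipFeasible A b := by
    refine ⟨?_, fun i => add_nonneg (hopt.1.2 i) (hz0 i)⟩
    rw [Matrix.mulVec_add, hopt.1.1, hz, Matrix.mulVec_sub, Matrix.mulVec_smul, Matrix.mulVec_smul,
      hAw, smul_smul, pow_two, sub_self, add_zero]
  have h1 := hopt.2 _ hfeas
  rw [cost_add] at h1
  have h2 : cost d z = (M.det : ℝ) ^ 2 * (d j - d ⬝ᵥ t) := by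
    rw [cost, hzr, dotProduct_smul, dotProduct_sub, dotProduct_single, smul_eq_mul, mul_one]
  nlinarith

/-- Under Gomory's condition at all feasible bases, an objective vector for which the integer
program has an optimal solution admits a feasible basis with nonnegative reduced costs. -/
theorem exists_dualFeasible_basis (hA : (realMatrix A).rank = m)
    (hG : ∀ B ∈ feasibleBases A b, ∀ hB : B.card = m, GomoryCondition A b B hB)
    {d : Fin n → ℝ} {x₀ : Fin n → ℤ} (hopt : IsOptimalSolution (ipFeasible A b) d x₀) :
    ∃ B ∈ feasibleBases A b, ∃ T : Fin n → Fin n → ℝ, (∀ j k, k ∉ B → T j k = 0) ∧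
      (∀ j, (realMatrix A).mulVec (T j) = (realMatrix A).mulVec (Pi.single j 1)) ∧
      ∀ j, j ∉ B → d ⬝ᵥ T j ≤ d j := by
  have hex : ∀ B ∈ feasibleBases A b, ∃ s : Fin n → ℝ, (∀ j, j ∉ B → s j = 0) ∧
      (∀ j, 0 ≤ s j) ∧ (realMatrix A).mulVec s = realVec b :=
    fun B hB => (mem_feasibleBases_iff.mp hB).2
  choose! s hs hs0 hsb using hex
  have hne : (feasibleBases A b).Nonempty := by
    obtain ⟨B, y, h, hyB, hy0, hy⟩ := exists_isColumnBasis_nonneg hA (x := realVec x₀)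
      (fun k => by simpa [realVec] using hopt.1.2 k)
    rw [realMatrix_mulVec, hopt.1.1] at hy
    exact ⟨B, mem_feasibleBases_iff.mpr ⟨h, y, hyB, hy0, hy⟩⟩
  obtain ⟨B, hB, hmin⟩ := Set.exists_min_image (feasibleBases A b) (fun B => d ⬝ᵥ s B)
    (Set.toFinite _) hne
  have h := (mem_feasibleBases_iff.mp hB).1
  choose T hT hTj using fun j => h.exists_coords ((realMatrix A).mulVec (Pi.single j 1))
  refine ⟨B, hB, T, hT, hTj, fun j hj => ?_⟩
  by_contra! hlt
  obtain ⟨r, hr⟩ := exists_coord_pos_of_optimal h hopt (hT j) (hTj j) hlt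
  have hAj : (realMatrix A).mulVec (Pi.single j 1) ≠ 0 := by
    intro hc
    have := h.2 (T j) (hT j) (by rw [hTj, hc])
    simp [this] at hr
  obtain ⟨B', x', h', hx', hx0, hxb, hc⟩ := h.exists_pivot (hs B hB)
    (pos_of_gomoryCondition h h.1 (hG B hB h.1) (hs B hB) (hs0 B hB) (hsb B hB) hj hAj)
    hj (hT j) (hTj j) hlt ⟨r, hr⟩
  rw [hsb B hB] at hxb
  have hB' : B' ∈ feasibleBases A b := mem_feasibleBases_iff.mpr ⟨h', x', hx', hx0, hxb⟩
  have : x' = s B' := h'.eq_of_mulVec_eq hx' (hs B' hB') (by rw [hxb, hsb B' hB'])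
  rw [this] at hc
  exact absurd (hmin B' hB') (not_le.mpr hc)

/-- Under Gomory's condition the inverse-feasible region of the integer program is the union of
those of its corner relaxations. -/
theorem iUnion_inverseFeasible_gcrFeasible (hA : (realMatrix A).rank = m)
    {x₀ : Fin n → ℤ} (hx₀ : x₀ ∈ ipFeasible A b)
    (hG : ∀ B ∈ feasibleBases A b, ∀ hB : B.card = m, GomoryCondition A b B hB) :
    (⋃ B ∈ feasibleBases A b, inverseFeasible (gcrFeasible A b B) x₀) =
      inverseFeasible (ipFeasible A b) x₀ := by
  apply Set.Subset.antisymm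
  · exact Set.iUnion₂_subset fun B _ => inverseFeasible_anti ipFeasible_subset_gcrFeasible hx₀
  · intro d hd
    obtain ⟨B, hB, T, hT, hTj, hred⟩ := exists_dualFeasible_basis hA hG hd
    obtain ⟨h, s, hs, hs0, hsb⟩ := mem_feasibleBases_iff.mp hB
    refine Set.mem_iUnion₂.mpr ⟨B, hB, ipFeasible_subset_gcrFeasible hx₀, fun y hy => ?_⟩
    obtain ⟨y', hy', hc, hlt⟩ := exists_gcrFeasible_sum_lt h hT hTj hred _ y hy rfl
    exact (hd.2 y' (mem_ipFeasible_of_gomoryCondition h (hG B hB h.1) hs hs0 hsb hy' hlt)).trans hc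

end Optimal

/-! ### Attainment in the inverse problems -/

section Attainment

variable {n : ℕ}

theorem isClosed_inverseFeasible {F : Set (Fin n → ℤ)} {x₀ : Fin n → ℤ} (hx₀ : x₀ ∈ F) :
    IsClosed (inverseFeasible F x₀) := by
  have : inverseFeasible F x₀ = ⋂ y ∈ F, {d | cost d x₀ ≤ cost d y} := by
    ext d
    simp only [Set.mem_iInter₂]
    exact ⟨fun h y hy => h.2 y hy, fun h => ⟨hx₀, fun y hy => h y hy⟩⟩
  rw [this]
  have hcost : ∀ x : Fin n → ℤ, Continuous fun d : Fin n → ℝ => cost d x := fun x =>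
    Continuous.dotProduct continuous_id continuous_const
  exact isClosed_biInter fun y _ => isClosed_le (hcost x₀) (hcost y)

/-- In the coordinates `z i = w i * (d i - c i)`, inverted by `g`, the objective is the `L_p` norm;
a nonempty closed set in finite dimension has a point nearest to the origin. -/
theorem exists_isInverseSolution {p : ℝ≥0∞} (hp : 1 ≤ p) {w : Fin n → ℝ} (hw : ∀ i, 0 < w i)
    (c : Fin n → ℝ) {F : Set (Fin n → ℤ)} {x₀ : Fin n → ℤ} (hx₀ : x₀ ∈ F) :
    ∃ d, IsInverseSolution p w c F x₀ d := by
  have : Fact (1 ≤ p) := ⟨hp⟩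
  let g : PiLp p (fun _ : Fin n => ℝ) → Fin n → ℝ := fun z i => c i + (w i)⁻¹ * z i
  have hg : Continuous g := by
    refine continuous_pi fun i => ?_
    exact continuous_const.add (continuous_const.mul (PiLp.continuous_apply p _ i))
  have hgd : ∀ d, g (WithLp.toLp p fun i => w i * (d i - c i)) = d := by
    intro d
    ext i
    have := (hw i).ne'
    simp only [g]
    field_simp
    ring
  have hgz : ∀ z, weightedDist p w c (g z) = ‖z‖ := by
    intro z
    unfold weightedDist
    congr 1
    ext i
    have := (hw i).ne'
    simp only [g]
    field_simp
    ring
  have hcl := (isClosed_inverseFeasible hx₀).preimage hg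
  -- The zero objective makes every feasible point optimal.
  have hne : (g ⁻¹' inverseFeasible F x₀).Nonempty :=
    ⟨WithLp.toLp p fun i => w i * ((0 : Fin n → ℝ) i - c i), by
      rw [Set.mem_preimage, hgd]
      exact ⟨hx₀, fun y _ => by simp [cost]⟩⟩
  obtain ⟨z, hz, hmin⟩ := hcl.exists_infDist_eq_dist hne 0
  refine ⟨g z, hz, fun e he => ?_⟩
  rw [← hgd e, hgz, hgz]
  have h1 := Metric.infDist_le_dist_of_mem (x := (0 : PiLp p fun _ : Fin n => ℝ))
    (show (WithLp.toLp p fun i => w i * (e i - c i)) ∈ g ⁻¹' inverseFeasible F x₀ by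
      rw [Set.mem_preimage, hgd]; exact he)
  rw [hmin, dist_zero_left, dist_zero_left] at h1
  exact h1

theorem isInverseValue_weightedDist {p : ℝ≥0∞} {w c d : Fin n → ℝ} {F : Set (Fin n → ℤ)}
    {x₀ : Fin n → ℤ} (h : IsInverseSolution p w c F x₀ d) :
    IsInverseValue p w c F x₀ (weightedDist p w c d) :=
  ⟨⟨d, h.1, rfl⟩, by rintro _ ⟨e, he, rfl⟩; exact h.2 e he⟩

end Attainment

theorem mainTheorem4 {m n : ℕ} (A : Matrix (Fin m) (Fin n) ℤ) (b : Fin m → ℤ)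
    (hA : (realMatrix A).rank = m)
    (x₀ : Fin n → ℤ) (hx₀ : x₀ ∈ ipFeasible A b)
    (hG : ∀ B ∈ feasibleBases A b, ∀ hB : B.card = m, GomoryCondition A b B hB) :
    (⋃ B ∈ feasibleBases A b, inverseFeasible (gcrFeasible A b B) x₀) =
        inverseFeasible (ipFeasible A b) x₀ ∧
      ∀ (p : ℝ≥0∞) (w c : Fin n → ℝ), 1 ≤ p → (∀ i, 0 < w i) →
        (∀ B ∈ feasibleBases A b, ∃ u, IsInverseValue p w c (gcrFeasible A b B) x₀ u) ∧
        ∃ v, IsInverseValue p w c (ipFeasible A b) x₀ v ∧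
          IsLeast {u | ∃ B ∈ feasibleBases A b,
            IsInverseValue p w c (gcrFeasible A b B) x₀ u} v ∧
          ∀ d, IsInverseSolution p w c (ipFeasible A b) x₀ d ↔
            ∃ B ∈ feasibleBases A b, IsInverseSolution p w c (gcrFeasible A b B) x₀ d ∧
              weightedDist p w c d = v := by
  have hU := iUnion_inverseFeasible_gcrFeasible hA hx₀ hG
  refine ⟨hU, fun p w c hp hw => ⟨fun B _ => ?_, ?_⟩⟩
  · obtain ⟨d, hd⟩ := exists_isInverseSolution hp hw c
      (ipFeasible_subset_gcrFeasible (B := B) hx₀)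
    exact ⟨_, isInverseValue_weightedDist hd⟩
  have hsub : ∀ B, inverseFeasible (gcrFeasible A b B) x₀ ⊆ inverseFeasible (ipFeasible A b) x₀ :=
    fun B => inverseFeasible_anti ipFeasible_subset_gcrFeasible hx₀
  -- An optimum over the union lies in one of its pieces and remains optimal on that smaller set.
  have hsol : ∀ d, IsInverseSolution p w c (ipFeasible A b) x₀ d →
      ∃ B ∈ feasibleBases A b, IsInverseSolution p w c (gcrFeasible A b B) x₀ d := by
    intro d hd
    obtain ⟨B, hB, hdB⟩ := Set.mem_iUnion₂.mp (hU.symm ▸ hd.1)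
    exact ⟨B, hB, hdB, fun e he => hd.2 e (hsub B he)⟩
  obtain ⟨d₀, hd₀⟩ := exists_isInverseSolution hp hw c hx₀
  refine ⟨_, isInverseValue_weightedDist hd₀, ⟨?_, ?_⟩, fun d => ⟨fun hd => ?_, ?_⟩⟩
  · obtain ⟨B, hB, hdB⟩ := hsol d₀ hd₀
    exact ⟨B, hB, isInverseValue_weightedDist hdB⟩
  · rintro u ⟨B, -, ⟨e, he, rfl⟩, -⟩
    exact hd₀.2 e (hsub B he)
  · obtain ⟨B, hB, hdB⟩ := hsol d hd
    exact ⟨B, hB, hdB, le_antisymm (hd.2 d₀ hd₀.1) (hd₀.2 d hd.1)⟩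
  · rintro ⟨B, -, hdB, hv⟩
    exact ⟨hsub B hdB.1, fun e he => hv ▸ hd₀.2 e he⟩
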